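/- Let $\mathcal H$ be a complex Hilbert space with an orthonormal basis $\{e_j^k\}_{j\in\mathbb N_0,\,1\le k\le d_j}$, where $d_j<\infty$ for every $j$, and put $H_j=\operatorname{span}\{e_j^k\}_{k=1}^{d_j}$, so that $\mathcal H=\bigoplus_{j\ge 0}H_j$. Let $T\in S_1(\mathcal H)$ be a trace class operator, i.e. $T$ is compact and $\|T\|_{S_1}=\sum_k s_k(T)<\infty$, where the $s_k(T)$ are the eigenvalues of $|T|=\sqrt{T^*T}$ counted with multiplicity. Suppose that $T$ is a Fourier multiplier (invariant operator) relative to $\{H_j\}$, i.e. $T(H_j)\subset H_j$ for all $j$, and let $\sigma_T(\ell)\in\mathbb C^{d_\ell\times d_\ell}$, $\sigma_T(\ell)_{mk}=(Te_\ell^k,e_\ell^m)_{\mathcal H}$, be its matrix symbol. For a finite rank operator $F$, let $\operatorname{Det}(I+F)=\operatorname{Det}(I+F|_M)$, where $M$ is a finite-dimensional subspace with $F(M)\subset M$ and with a complement contained in $\ker F$; for $A\in S_1(\mathcal H)$, let $\operatorname{Det}(I+A)=\lim_{F}\operatorname{Det}(I+F)$, the limit being taken over finite rank operators $F$ with $\|A-F\|_{S_1}\to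 0$. Then for every $m\ge 1$ the series $\sum_{\ell}\operatorname{Tr}(\sigma_T(\ell)^m)$ converges absolutely, and there is $r>0$ such that for all $\lambda\in\mathbb C$ with $|\lambda|<r$ the determinant $\operatorname{Det}(I+\lambda T)$ exists, the series over $m$ below converges absolutely, and $$\operatorname{Det}(I+\lambda T)=\exp\Big(\sum_{m=1}^{\infty}\frac{(-1)^{m+1}}{m}\,\lambda^m\sum_{\ell=0}^{\infty}\operatorname{Tr}(\sigma_T(\ell)^m)\Big).$$ -/

import Mathlib

open Filter Topology
open scoped ENNReal NNReal

noncomputable section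

namespace InvariantDet

section TraceClass

variable {H : Type*} [NormedAddCommGroup H] [InnerProductSpace ℂ H]

/-- `F` has finite rank. -/
def IsFiniteRank (F : H →L[ℂ] H) : Prop :=
  FiniteDimensional ℂ (LinearMap.range (F : H →ₗ[ℂ] H))

/-- For `F` of finite rank, a finite-dimensional subspace `M` with `F(M) ⊆ M` whose orthogonal
complement is contained in `ker F` (see the next three lemmas). -/
def supportSpace (F : H →L[ℂ] H) : Submodule ℂ H :=
  LinearMap.range (F : H →ₗ[ℂ] H) ⊔ (LinearMap.ker (F : H →ₗ[ℂ] H))ᗮ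

theorem mapsTo_supportSpace (F : H →L[ℂ] H) :
    ∀ x ∈ supportSpace F, (F : H →ₗ[ℂ] H) x ∈ supportSpace F :=
  fun x _ => Submodule.mem_sup_left ⟨x, rfl⟩

theorem supportSpace_orthogonal_le [CompleteSpace H] (F : H →L[ℂ] H) :
    (supportSpace F)ᗮ ≤ LinearMap.ker (F : H →ₗ[ℂ] H) := by
  have h : (supportSpace F)ᗮ ≤ (LinearMap.ker (F : H →ₗ[ℂ] H))ᗮᗮ :=
    Submodule.orthogonal_le le_sup_right
  have hc : IsClosed ((LinearMap.ker (F : H →ₗ[ℂ] H) : Submodule ℂ H) : Set H) :=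
    F.isClosed_ker
  rwa [Submodule.orthogonal_orthogonal_eq_closure, hc.submodule_topologicalClosure_eq] at h

theorem finiteDimensional_supportSpace {F : H →L[ℂ] H} (hF : IsFiniteRank F) :
    FiniteDimensional ℂ (supportSpace F) := by
  have : FiniteDimensional ℂ (LinearMap.range (F : H →ₗ[ℂ] H)) := hF
  have : FiniteDimensional ℂ (LinearMap.ker (F : H →ₗ[ℂ] H))ᗮ := by
    refine FiniteDimensional.of_injective
      ((F : H →ₗ[ℂ] H).rangeRestrict.comp (LinearMap.ker (F : H →ₗ[ℂ] H))ᗮ.subtype) ?_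
    rw [← LinearMap.ker_eq_bot, LinearMap.ker_eq_bot']
    rintro ⟨x, hx⟩ h
    have hx0 : x ∈ LinearMap.ker (F : H →ₗ[ℂ] H) := by
      simpa using congrArg Subtype.val h
    have := Submodule.inner_right_of_mem_orthogonal hx0 hx
    exact Subtype.ext (inner_self_eq_zero.mp this)
  exact Submodule.finiteDimensional_sup _ _

/-- `Det(I + F)` for `F` of finite rank: with respect to `H = M ⊕ Mᗮ`, `M = supportSpace F`, the
operator `I + F` is `(I + F|_M) ⊕ I`, and `Det(I + F)` is the determinant of `I + F|_M` on the
finite-dimensional space `M`. -/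
def finiteRankDet (F : H →L[ℂ] H) : ℂ :=
  LinearMap.det (LinearMap.id + (F : H →ₗ[ℂ] H).restrict (mapsTo_supportSpace F))

variable [CompleteSpace H]

/-- The trace norm `‖T‖_{S₁} = ∑ₖ sₖ(T)` of a compact operator `T`: the sum, with multiplicities,
of the singular values of `T`, i.e. of the eigenvalues of `|T| = √(T* T)`. A number `s > 0` is
counted as often as the dimension of the eigenspace of `|T|` at `s`. -/
def traceNorm (T : H →L[ℂ] H) : ℝ≥0∞ :=
  ∑' s : ℝ≥0,
    (Module.finrank ℂ (Module.End.eigenspace ((CFC.abs T : H →L[ℂ] H) : H →ₗ[ℂ] H) ((s : ℝ) : ℂ)) :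
      ℝ≥0∞) * (s : ℝ≥0∞)

/-- `T` belongs to the trace class `S₁(H)`: it is compact and its singular values, counted with
multiplicity, have a finite sum. -/
structure IsTraceClass (T : H →L[ℂ] H) : Prop where
  isCompact : IsCompactOperator T
  traceNorm_lt_top : traceNorm T < ∞

/-- The filter of finite rank operators `F` with `‖T - F‖_{S₁} → 0`. -/
def finiteRankNhds (T : H →L[ℂ] H) : Filter (H →L[ℂ] H) :=
  comap (fun F => traceNorm (T - F)) (𝓝 0) ⊓ 𝓟 {F | IsFiniteRank F}

/-- `d` is the determinant of `I + T`: the finite rank operators accumulate at `T` in the trace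
norm, and `Det(I + F) → d` as `F → T` in the trace norm along the finite rank operators. -/
def HasDet (T : H →L[ℂ] H) (d : ℂ) : Prop :=
  (finiteRankNhds T).NeBot ∧ Tendsto finiteRankDet (finiteRankNhds T) (𝓝 d)

/-- The determinant `Det(I + T)` of the trace class operator `T`: the limit of `Det(I + F)` as
`F → T` in the trace norm along the finite rank operators. -/
def traceClassDet (T : H →L[ℂ] H) : ℂ :=
  limUnder (finiteRankNhds T) finiteRankDet

theorem HasDet.traceClassDet_eq {T : H →L[ℂ] H} {d : ℂ} (h : HasDet T d) :
    traceClassDet T = d :=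
  haveI := h.1
  h.2.limUnder_eq

end TraceClass

section FourierMultiplier

variable {H : Type*} [NormedAddCommGroup H] [InnerProductSpace ℂ H]

/-- The subspace `H_j = span {e_j^k : k}` for an orthonormal basis `(e_j^k)`. -/
def block {d : ℕ → ℕ} (e : HilbertBasis (Σ j : ℕ, Fin (d j)) ℂ H) (j : ℕ) : Submodule ℂ H :=
  Submodule.span ℂ (Set.range fun k : Fin (d j) => e ⟨j, k⟩)

/-- `T` is a Fourier multiplier (invariant) relative to the decomposition `H = ⨁ H_j`:
`T(H_j) ⊆ H_j` for all `j`. -/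
def IsFourierMultiplier {d : ℕ → ℕ} (e : HilbertBasis (Σ j : ℕ, Fin (d j)) ℂ H)
    (T : H →L[ℂ] H) : Prop :=
  ∀ j, ∀ x ∈ block e j, T x ∈ block e j

/-- The matrix symbol `σ_T(ℓ)`, with entries `σ_T(ℓ)_{mk} = (T e_ℓ^k, e_ℓ^m)`. The inner product is
written in Mathlib's convention, conjugate linear in the first variable. -/
def matrixSymbol {d : ℕ → ℕ} (e : HilbertBasis (Σ j : ℕ, Fin (d j)) ℂ H) (T : H →L[ℂ] H) (l : ℕ) :
    Matrix (Fin (d l)) (Fin (d l)) ℂ :=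
  Matrix.of fun m k => inner ℂ (e ⟨l, m⟩) (T (e ⟨l, k⟩))

end FourierMultiplier

end InvariantDet

end

/-! For finite rank `F` with `‖F‖ < 1`, comparing eigenvalues gives `Det(I + F) = exp(∑ (-1)^(m+1)/m
· Tr F^m)`. It remains to extend this along `F → A` in the trace norm and to compute the traces for
a Fourier multiplier. The Schmidt expansion (`IsTraceClass.hasNuclearBound`) writes a trace class
operator as a sum of rank one operators whose norms add up to at most its trace norm. Such a bound
controls the trace in any orthonormal basis. Applied to `A - F` itself, it also avoids any triangle
inequality for the trace norm. Telescoping bounds the trace of `A^m - F^m` by `m ρ^(m-1) ‖A -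
F‖_{S₁}` when `‖A‖, ‖F‖ ≤ ρ`. The coefficient `1/m` cancels the factor `m`, so for `ρ < 1` the
logarithmic series converge together (`IsTraceClass.norm_tsum_logDetTerm_sub_le`), and
exponentiating gives `IsTraceClass.hasDet_exp`. A Fourier multiplier acts on each block by its
symbol, so grouping the diagonal of `T^m` by blocks yields `∑ Tr(σ_T(ℓ)^m)`. -/

open Filter Topology
open scoped ENNReal NNReal

noncomputable section

namespace InvariantDet

/-! ### Eigenvalues, determinants and traces in finite dimension. -/

section FiniteDimensional

open Polynomial

variable {K V : Type*} [Field K] [AddCommGroup V] [Module K V] [FiniteDimensional K V]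

theorem det_sub_algebraMap (f : Module.End K V) (c : K) :
    LinearMap.det (f - algebraMap K (Module.End K V) c) =
      (-1) ^ Module.finrank K V * f.charpoly.eval c := by
  rw [LinearMap.det_eq_sign_charpoly_coeff, Algebra.algebraMap_eq_smul_one,
    Polynomial.coeff_zero_eq_eval_zero, LinearMap.charpoly_sub_smul]
  simp

theorem det_algebraMap_sub (f : Module.End K V) (c : K) :
    LinearMap.det (algebraMap K (Module.End K V) c - f) = f.charpoly.eval c := by
  rw [← neg_sub f, ← neg_one_smul K, LinearMap.det_smul, det_sub_algebraMap, ← mul_assoc,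
    ← mul_pow]
  simp

variable [IsAlgClosed K]

theorem charpoly_eval_eq_prod_roots (f : Module.End K V) (c : K) :
    f.charpoly.eval c = (f.charpoly.roots.map fun a => c - a).prod := by
  conv_lhs =>
    rw [(IsAlgClosed.splits f.charpoly).eq_prod_roots_of_monic f.charpoly_monic]
  rw [Polynomial.eval_multiset_prod, Multiset.map_map]
  simp

theorem card_roots_charpoly (f : Module.End K V) :
    Multiset.card f.charpoly.roots = Module.finrank K V := by
  rw [← LinearMap.charpoly_natDegree f, (IsAlgClosed.splits f.charpoly).natDegree_eq_card_roots]

/-- Both sides are multiplicative in `p`, so splitting `p` reduces the claim to linear factors and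
constants. -/
theorem det_aeval_eq_prod_roots_charpoly (f : Module.End K V) (p : K[X]) :
    LinearMap.det (aeval f p) = (f.charpoly.roots.map fun a => p.eval a).prod := by
  obtain ⟨m, hm⟩ := splits_iff_exists_multiset.mp (IsAlgClosed.splits p)
  generalize p.leadingCoeff = c at hm
  subst hm
  induction m using Multiset.induction with
  | empty =>
    simp [card_roots_charpoly, Algebra.algebraMap_eq_smul_one, LinearMap.det_smul]
  | cons b m ih =>
    have h : (C c * (Multiset.map (fun a => X - C a) (b ::ₘ m)).prod) =
        (X - C b) * (C c * (Multiset.map (fun a => X - C a) m).prod) := by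
      simp only [Multiset.map_cons, Multiset.prod_cons]; ring
    rw [h, map_mul, map_mul, ih]
    simp only [eval_mul (p := X - C b), Multiset.prod_map_mul]
    congr 1
    simp only [map_sub, aeval_X, aeval_C, eval_sub, eval_X, eval_C]
    rw [det_sub_algebraMap, charpoly_eval_eq_prod_roots, ← card_roots_charpoly f]
    generalize f.charpoly.roots = s
    induction s using Multiset.induction with
    | empty => simp
    | cons a s ih =>
      simp only [Multiset.card_cons, Multiset.map_cons, Multiset.prod_cons, ← ih]
      ring

/-- Spectral mapping with multiplicities: the determinant formula for `p = t - X^m` identifies the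
two characteristic polynomials at every `t` of an infinite field. -/
theorem roots_charpoly_pow (f : Module.End K V) (m : ℕ) :
    (f ^ m).charpoly.roots = f.charpoly.roots.map (· ^ m) := by
  have h : (f ^ m).charpoly = ((f.charpoly.roots.map (· ^ m)).map fun a => X - C a).prod := by
    have : Infinite K := IsAlgClosed.instInfinite
    refine Polynomial.funext fun t => ?_
    have := det_aeval_eq_prod_roots_charpoly f (C t - X ^ m)
    simp only [map_sub, aeval_C, map_pow, aeval_X, det_algebraMap_sub] at this
    rw [this, Polynomial.eval_multiset_prod, Multiset.map_map, Multiset.map_map]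
    simp
  rw [h, Polynomial.roots_multiset_prod_X_sub_C]

theorem trace_pow_eq_sum_roots_charpoly (f : Module.End K V) (m : ℕ) :
    LinearMap.trace K V (f ^ m) = (f.charpoly.roots.map (· ^ m)).sum := by
  rw [Module.End.trace_eq_sum_roots_charpoly_of_splits (IsAlgClosed.splits _), roots_charpoly_pow]

end FiniteDimensional

/-! ### The logarithm of a finite-dimensional determinant. -/

section LogDet

variable {V : Type*} [NormedAddCommGroup V] [NormedSpace ℂ V] [FiniteDimensional ℂ V]

theorem hasSum_log_one_add_pnat {z : ℂ} (hz : ‖z‖ < 1) :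
    HasSum (fun m : ℕ+ => (-1 : ℂ) ^ ((m : ℕ) + 1) / ((m : ℕ) : ℂ) * z ^ (m : ℕ))
      (Complex.log (1 + z)) := by
  have h := Complex.hasSum_taylorSeries_log hz
  -- The term at `n = 0` is a division by zero, hence `0`, and may be dropped.
  have h0 := (hasSum_subtype_iff_of_support_subset (s := {n : ℕ | 0 < n}) ?_).2 h
  · have heq : (fun m : ℕ+ => (-1 : ℂ) ^ ((m : ℕ) + 1) / ((m : ℕ) : ℂ) * z ^ (m : ℕ)) =
        fun m : ℕ+ => (-1 : ℂ) ^ ((m : ℕ) + 1) * z ^ (m : ℕ) / ((m : ℕ) : ℂ) :=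
      funext fun m => div_mul_eq_mul_div _ _ _
    rw [heq]
    exact h0
  · intro n hn
    rcases Nat.eq_zero_or_pos n with rfl | h
    · simp at hn
    · exact h

/-- `det(1 + f) = exp(tr log(1 + f))` for `‖f‖ < 1`. -/
theorem exp_tsum_trace_pow_eq_det (f : Module.End ℂ V) {ρ : ℝ} (hρ : ρ < 1)
    (hf : ∀ x, ‖f x‖ ≤ ρ * ‖x‖) :
    Complex.exp (∑' m : ℕ+, (-1 : ℂ) ^ ((m : ℕ) + 1) / ((m : ℕ) : ℂ) *
      LinearMap.trace ℂ V (f ^ (m : ℕ))) = LinearMap.det (LinearMap.id + f) := by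
  have hlt : ∀ a ∈ f.charpoly.roots, ‖a‖ < 1 := fun a ha => by
    have hev : f.HasEigenvalue a := (Module.End.hasEigenvalue_iff_isRoot_charpoly f a).2
      (Polynomial.isRoot_of_mem_roots ha)
    obtain ⟨v, hv⟩ := hev.exists_hasEigenvector
    have h := hf v
    rw [hv.apply_eq_smul, norm_smul] at h
    exact (le_of_mul_le_mul_right h (norm_pos_iff.2 hv.2)).trans_lt hρ
  have hdet := det_aeval_eq_prod_roots_charpoly f (1 + Polynomial.X)
  simp only [map_add, map_one, Polynomial.aeval_X, Polynomial.eval_add, Polynomial.eval_one,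
    Polynomial.eval_X] at hdet
  change _ = LinearMap.det (1 + f)
  rw [hdet]
  simp only [trace_pow_eq_sum_roots_charpoly]
  generalize f.charpoly.roots = s at hlt
  suffices h : HasSum (fun m : ℕ+ => (-1 : ℂ) ^ ((m : ℕ) + 1) / ((m : ℕ) : ℂ) *
      (s.map (· ^ (m : ℕ))).sum) (s.map fun a => Complex.log (1 + a)).sum by
    rw [h.tsum_eq, Complex.exp_multiset_sum, Multiset.map_map]
    refine congrArg _ (Multiset.map_congr rfl fun a ha => ?_)
    -- `1 + a = 0` would force `‖a‖ = 1`.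
    refine Complex.exp_log fun h0 => ?_
    have := hlt a ha
    rw [← neg_eq_of_add_eq_zero_right h0] at this
    simp at this
  induction s using Multiset.induction with
  | empty => simp
  | cons a s ih =>
    simp only [Multiset.map_cons, Multiset.sum_cons, mul_add]
    exact (hasSum_log_one_add_pnat (hlt a (by simp))).add
      (ih fun b hb => hlt b (Multiset.mem_cons_of_mem hb))

end LogDet

/-! ### Nuclear expansions and their stability. -/

section Nuclear

variable {H : Type*} [NormedAddCommGroup H] [InnerProductSpace ℂ H]

/-- `A` has a nuclear expansion `A x = ∑ᵢ ⟨aᵢ, x⟩ bᵢ` with `∑ᵢ ‖aᵢ‖ ‖bᵢ‖ ≤ C`. -/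
def HasNuclearBound (A : H →L[ℂ] H) (C : ℝ) : Prop :=
  ∃ (ι : Type) (a b : ι → H), (Summable fun i => ‖a i‖ * ‖b i‖) ∧ ∑' i, ‖a i‖ * ‖b i‖ ≤ C ∧
    ∀ x, HasSum (fun i => inner ℂ (a i) x • b i) (A x)

namespace HasNuclearBound

variable {A B : H →L[ℂ] H} {C D : ℝ}

theorem nonneg (h : HasNuclearBound A C) : 0 ≤ C := by
  obtain ⟨ι, a, b, -, hC, -⟩ := h
  exact (tsum_nonneg fun i => by positivity).trans hC

theorem mono (h : HasNuclearBound A C) (hCD : C ≤ D) : HasNuclearBound A D := by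
  obtain ⟨ι, a, b, hs, hC, hx⟩ := h
  exact ⟨ι, a, b, hs, hC.trans hCD, hx⟩

theorem norm_le (h : HasNuclearBound A C) : ‖A‖ ≤ C := by
  refine A.opNorm_le_bound h.nonneg fun x => ?_
  obtain ⟨ι, a, b, hs, hC, hx⟩ := h
  rw [← (hx x).tsum_eq]
  have hle : ∀ i, ‖inner ℂ (a i) x • b i‖ ≤ ‖a i‖ * ‖b i‖ * ‖x‖ := fun i => by
    rw [norm_smul, mul_right_comm]
    exact mul_le_mul_of_nonneg_right (norm_inner_le_norm _ _) (norm_nonneg _)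
  refine (tsum_of_norm_bounded (hs.hasSum.mul_right ‖x‖) hle).trans ?_
  exact mul_le_mul_of_nonneg_right hC (norm_nonneg _)

theorem add (hA : HasNuclearBound A C) (hB : HasNuclearBound B D) :
    HasNuclearBound (A + B) (C + D) := by
  obtain ⟨ι, a, b, hs, hC, hx⟩ := hA
  obtain ⟨κ, a', b', hs', hD, hx'⟩ := hB
  have h : HasSum (fun i : ι ⊕ κ => ‖Sum.elim a a' i‖ * ‖Sum.elim b b' i‖) _ :=
    HasSum.sum hs.hasSum hs'.hasSum
  exact ⟨ι ⊕ κ, Sum.elim a a', Sum.elim b b', h.summable, h.tsum_eq.trans_le (add_le_add hC hD),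
    fun x => HasSum.sum (hx x) (hx' x)⟩

theorem mul_left (h : HasNuclearBound A C) (B : H →L[ℂ] H) :
    HasNuclearBound (B * A) (‖B‖ * C) := by
  obtain ⟨ι, a, b, hs, hC, hx⟩ := h
  have hle : ∀ i, ‖a i‖ * ‖B (b i)‖ ≤ ‖B‖ * (‖a i‖ * ‖b i‖) := fun i => by
    rw [mul_left_comm]
    exact mul_le_mul_of_nonneg_left (B.le_opNorm _) (norm_nonneg _)
  have hs' : Summable fun i => ‖a i‖ * ‖B (b i)‖ :=
    (hs.mul_left ‖B‖).of_nonneg_of_le (fun i => by positivity) hle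
  refine ⟨ι, a, fun i => B (b i), hs', ?_, fun x => ?_⟩
  · refine (hs'.tsum_le_tsum hle (hs.mul_left _)).trans ?_
    rw [tsum_mul_left]
    exact mul_le_mul_of_nonneg_left hC (norm_nonneg _)
  · simpa using B.hasSum (hx x)

theorem mul_right [CompleteSpace H] (h : HasNuclearBound A C) (B : H →L[ℂ] H) :
    HasNuclearBound (A * B) (C * ‖B‖) := by
  obtain ⟨ι, a, b, hs, hC, hx⟩ := h
  have hle : ∀ i, ‖ContinuousLinearMap.adjoint B (a i)‖ * ‖b i‖ ≤ (‖a i‖ * ‖b i‖) * ‖B‖ :=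
    fun i => by
      rw [mul_right_comm, mul_comm ‖a i‖]
      refine mul_le_mul_of_nonneg_right ?_ (norm_nonneg _)
      exact ((ContinuousLinearMap.adjoint B).le_opNorm _).trans_eq (by simp)
  have hs' : Summable fun i => ‖ContinuousLinearMap.adjoint B (a i)‖ * ‖b i‖ :=
    (hs.mul_right ‖B‖).of_nonneg_of_le (fun i => by positivity) hle
  refine ⟨ι, fun i => ContinuousLinearMap.adjoint B (a i), b, hs', ?_, fun x => ?_⟩
  · refine (hs'.tsum_le_tsum hle (hs.mul_right _)).trans ?_
    rw [tsum_mul_right]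
    exact mul_le_mul_of_nonneg_right hC (norm_nonneg _)
  · simpa [ContinuousLinearMap.adjoint_inner_left] using hx (B x)

theorem pow_succ (h : HasNuclearBound A C) (k : ℕ) :
    HasNuclearBound (A ^ (k + 1)) (‖A‖ ^ k * C) := by
  induction k with
  | zero => simpa using h
  | succ k ih =>
    rw [_root_.pow_succ' A]
    exact (ih.mul_left A).mono (by rw [_root_.pow_succ', mul_assoc])

/-- Each of the `k + 1` telescoping terms contains one factor `A - B` and `k` factors of norm at
most `ρ`. Only the difference has to be nuclear. -/
theorem pow_sub_pow [CompleteSpace H] {ρ : ℝ} (h : HasNuclearBound (A - B) C) (hA : ‖A‖ ≤ ρ)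
    (hB : ‖B‖ ≤ ρ) (k : ℕ) :
    HasNuclearBound (A ^ (k + 1) - B ^ (k + 1)) ((k + 1 : ℕ) * ρ ^ k * C) := by
  have hρ : 0 ≤ ρ := (norm_nonneg _).trans hA
  induction k with
  | zero => simpa using h
  | succ k ih =>
    have heq : A ^ (k + 1 + 1) - B ^ (k + 1 + 1) =
        A * (A ^ (k + 1) - B ^ (k + 1)) + (A - B) * B ^ (k + 1) := by
      rw [_root_.pow_succ' A, _root_.pow_succ' B (k + 1)]; noncomm_ring
    rw [heq]
    refine ((ih.mul_left A).add (h.mul_right _)).mono ?_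
    have h1 : ‖A‖ * ((k + 1 : ℕ) * ρ ^ k * C) ≤ ρ * ((k + 1 : ℕ) * ρ ^ k * C) :=
      mul_le_mul_of_nonneg_right hA ih.nonneg
    have h2 : C * ‖B ^ (k + 1)‖ ≤ C * ρ ^ (k + 1) :=
      mul_le_mul_of_nonneg_left ((norm_pow_le' B k.succ_pos).trans
        (pow_le_pow_left₀ (norm_nonneg _) hB _)) h.nonneg
    refine (add_le_add h1 h2).trans_eq ?_
    push_cast
    ring

end HasNuclearBound

/-! ### The trace in an orthonormal basis. -/

section Trace

variable {κ : Type*} (e : HilbertBasis κ ℂ H)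

/-- The trace of an operator with respect to an orthonormal basis. -/
def basisTrace (A : H →L[ℂ] H) : ℂ := ∑' i, inner ℂ (e i) (A (e i))

/-- Cauchy–Schwarz followed by Bessel's inequality. -/
theorem sum_norm_inner_mul_norm_inner_le (x y : H) (s : Finset κ) :
    ∑ i ∈ s, ‖inner ℂ x (e i)‖ * ‖inner ℂ (e i) y‖ ≤ ‖x‖ * ‖y‖ := by
  refine (Real.sum_mul_le_sqrt_mul_sqrt _ _ _).trans ?_
  have h : ∀ z : H, √(∑ i ∈ s, ‖inner ℂ (e i) z‖ ^ 2) ≤ ‖z‖ := fun z =>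
    Real.sqrt_le_iff.2 ⟨norm_nonneg _, e.orthonormal.sum_inner_products_le z⟩
  refine mul_le_mul ?_ (h y) (Real.sqrt_nonneg _) (norm_nonneg _)
  simpa only [norm_inner_symm] using h x

/-- The diagonal entries of a nuclear operator are the row sums of an absolutely summable double
family whose column sums are `⟨aₙ, bₙ⟩`. -/
theorem hasSum_diag_of_nuclear {A : H →L[ℂ] H} {ι : Type*} {a b : ι → H}
    (hs : Summable fun i => ‖a i‖ * ‖b i‖)
    (hx : ∀ x, HasSum (fun i => inner ℂ (a i) x • b i) (A x)) :
    (Summable fun i => ‖inner ℂ (e i) (A (e i))‖) ∧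
      HasSum (fun i => inner ℂ (e i) (A (e i))) (∑' n, inner ℂ (a n) (b n)) := by
  let f : ι × κ → ℂ := fun p => inner ℂ (a p.1) (e p.2) * inner ℂ (e p.2) (b p.1)
  have hbd : ∀ n (s : Finset κ), ∑ i ∈ s, ‖f (n, i)‖ ≤ ‖a n‖ * ‖b n‖ := fun n s => by
    simpa only [f, norm_mul] using sum_norm_inner_mul_norm_inner_le e (a n) (b n) s
  have hrow : ∀ n, Summable fun i => ‖f (n, i)‖ := fun n =>
    summable_of_sum_le (fun i => norm_nonneg _) (hbd n)
  have hcol : ∀ i, HasSum (fun n => f (n, i)) (inner ℂ (e i) (A (e i))) := fun i => by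
    have h := (innerSL ℂ (e i)).hasSum (hx (e i))
    simpa only [innerSL_apply_apply, inner_smul_right] using h
  have hrow' : ∀ n, HasSum (fun i => f (n, i)) (inner ℂ (a n) (b n)) := fun n =>
    e.hasSum_inner_mul_inner (a n) (b n)
  clear_value f
  have hf : Summable fun p => ‖f p‖ := by
    refine (summable_prod_of_nonneg fun p => norm_nonneg _).2 ⟨hrow, ?_⟩
    exact hs.of_nonneg_of_le (fun n => tsum_nonneg fun i => norm_nonneg _) fun n =>
      (hrow n).tsum_le_of_sum_le (hbd n)
  have hsum : HasSum f (∑' n, inner ℂ (a n) (b n)) := by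
    have h := hf.of_norm.hasSum
    rwa [← (h.prod_fiberwise hrow').tsum_eq] at h
  -- Absolute summability allows the exchange: summing over `i` first gives `⟨aₙ, bₙ⟩` by Parseval,
  -- over `n` first the diagonal entries.
  have hswap : HasSum (fun p : κ × ι => f p.swap) (∑' n, inner ℂ (a n) (b n)) :=
    (Equiv.prodComm κ ι).hasSum_iff.2 hsum
  refine ⟨?_, hswap.prod_fiberwise hcol⟩
  have hn : Summable fun p : κ × ι => ‖f p.swap‖ := hf.prod_symm
  have hn' := (summable_prod_of_nonneg fun p => norm_nonneg _).1 hn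
  refine hn'.2.of_nonneg_of_le (fun i => norm_nonneg _) fun i => ?_
  rw [← (hcol i).tsum_eq]
  exact norm_tsum_le_tsum_norm (hn'.1 i)

namespace HasNuclearBound

variable {A B : H →L[ℂ] H} {C : ℝ}

theorem hasSum_basisTrace (h : HasNuclearBound A C) :
    HasSum (fun i => inner ℂ (e i) (A (e i))) (basisTrace e A) := by
  obtain ⟨ι, a, b, hs, -, hx⟩ := h
  exact (hasSum_diag_of_nuclear e hs hx).2.summable.hasSum

theorem norm_basisTrace_le (h : HasNuclearBound A C) : ‖basisTrace e A‖ ≤ C := by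
  obtain ⟨ι, a, b, hs, hC, hx⟩ := h
  rw [basisTrace, (hasSum_diag_of_nuclear e hs hx).2.tsum_eq]
  exact (tsum_of_norm_bounded hs.hasSum fun n => norm_inner_le_norm _ _).trans hC

/-- No expansion of `B` is needed: its diagonal is the difference of two summable ones. -/
theorem basisTrace_sub (hA : HasNuclearBound A C) {D : ℝ} (h : HasNuclearBound (A - B) D) :
    basisTrace e (A - B) = basisTrace e A - basisTrace e B := by
  have h1 := (hA.hasSum_basisTrace e).sub (h.hasSum_basisTrace e)
  have h2 : basisTrace e B = basisTrace e A - basisTrace e (A - B) := by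
    rw [← h1.tsum_eq]
    exact tsum_congr fun i => by simp
  rw [h2]; ring

end HasNuclearBound

theorem basisTrace_smul (z : ℂ) (A : H →L[ℂ] H) :
    basisTrace e (z • A) = z * basisTrace e A := by
  simp [basisTrace, tsum_mul_left]

/-- The trace of an operator that maps a finite-dimensional subspace `M` to itself and vanishes on
`Mᗮ` is the trace of its restriction to `M`. -/
theorem basisTrace_eq_trace_restrict (A : H →L[ℂ] H) (M : Submodule ℂ H) [FiniteDimensional ℂ M]
    (hM : ∀ x ∈ M, (A : H →ₗ[ℂ] H) x ∈ M) (hker : Mᗮ ≤ LinearMap.ker (A : H →ₗ[ℂ] H)) :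
    basisTrace e A = LinearMap.trace ℂ M ((A : H →ₗ[ℂ] H).restrict hM) := by
  let u := stdOrthonormalBasis ℂ M
  -- `A` factors through the projection onto `M`, which gives a finite nuclear expansion.
  have hx : ∀ x, HasSum (fun i => inner ℂ (u i : H) x • A (u i)) (A x) := fun x => by
    have h1 : A x = A (M.starProjection x) := by
      have := hker (M.sub_starProjection_mem_orthogonal x)
      rw [LinearMap.mem_ker, map_sub, sub_eq_zero] at this
      exact this
    have h2 : M.starProjection x = ∑ i, inner ℂ (u i : H) x • (u i : H) := by
      rw [Submodule.starProjection_apply, ← u.sum_repr' (M.orthogonalProjectionOnto x)]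
      simp
    rw [h1, h2, map_sum]
    simp only [map_smul]
    exact hasSum_fintype _
  rw [basisTrace, (hasSum_diag_of_nuclear e (hasSum_fintype _).summable hx).2.tsum_eq,
    LinearMap.trace_eq_sum_inner _ u, tsum_fintype]
  rfl

end Trace
end Nuclear

/-! ### Eigenspaces of `|A|` and the Schmidt expansion. -/

section SingularValues

variable {H : Type*} [NormedAddCommGroup H] [InnerProductSpace ℂ H] [CompleteSpace H]

open Module.End ContinuousLinearMap

theorem norm_cfcAbs_apply (A : H →L[ℂ] H) (x : H) : ‖(CFC.abs A : H →L[ℂ] H) x‖ = ‖A x‖ := by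
  have hsa : adjoint (CFC.abs A : H →L[ℂ] H) = CFC.abs A := (CFC.abs_nonneg A).isSelfAdjoint
  have h : ∀ B : H →L[ℂ] H, inner ℂ (B x) (B x) = inner ℂ x ((star B * B) x) := fun B => by
    rw [star_eq_adjoint, mul_apply_eq_comp, adjoint_inner_right]
  have h2 : inner ℂ ((CFC.abs A : H →L[ℂ] H) x) ((CFC.abs A : H →L[ℂ] H) x) =
      inner ℂ (A x) (A x) := by
    rw [h A, ← CFC.abs_mul_abs, h, star_eq_adjoint, hsa]
  rw [inner_self_eq_norm_sq_to_K, inner_self_eq_norm_sq_to_K] at h2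
  exact (sq_eq_sq₀ (norm_nonneg _) (norm_nonneg _)).1 (by exact_mod_cast h2)

theorem isSymmetric_cfcAbs (A : H →L[ℂ] H) :
    ((CFC.abs A : H →L[ℂ] H) : H →ₗ[ℂ] H).IsSymmetric :=
  ((nonneg_iff_isPositive _).1 (CFC.abs_nonneg A)).isSymmetric

/-- The eigenspace of `|A|` at `s`. -/
abbrev singularSpace (A : H →L[ℂ] H) (s : ℝ≥0) : Submodule ℂ H :=
  Module.End.eigenspace ((CFC.abs A : H →L[ℂ] H) : H →ₗ[ℂ] H) ((s : ℝ) : ℂ)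

theorem mem_singularSpace {A : H →L[ℂ] H} {s : ℝ≥0} {x : H} :
    x ∈ singularSpace A s ↔ (CFC.abs A : H →L[ℂ] H) x = ((s : ℝ) : ℂ) • x :=
  Module.End.mem_eigenspace_iff

theorem exists_singularSpace_of_mem_eigenspace {A : H →L[ℂ] H} {μ : ℂ} {x : H} (hx0 : x ≠ 0)
    (hx : x ∈ eigenspace ((CFC.abs A : H →L[ℂ] H) : H →ₗ[ℂ] H) μ) :
    ∃ s : ℝ≥0, x ∈ singularSpace A s := by
  have hev : HasEigenvalue ((CFC.abs A : H →L[ℂ] H) : H →ₗ[ℂ] H) μ :=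
    hasEigenvalue_of_hasEigenvector ⟨hx, hx0⟩
  have hre : ((μ.re : ℝ) : ℂ) = μ :=
    Complex.conj_eq_iff_re.1 ((isSymmetric_cfcAbs A).conj_eigenvalue_eq_self hev)
  have hpos : 0 ≤ μ.re := by
    refine eigenvalue_nonneg_of_nonneg (T := ((CFC.abs A : H →L[ℂ] H) : H →ₗ[ℂ] H))
      (by rw [← hre] at hev; exact hev) fun y => ?_
    exact ((nonneg_iff_isPositive _).1 (CFC.abs_nonneg A)).re_inner_nonneg_right y
  refine ⟨⟨μ.re, hpos⟩, ?_⟩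
  rw [← hre] at hx
  exact hx

/-- Compactness is immediate for `|A|² = A* A`; the spectral facts about `|A|` below are drawn from
its square. -/
theorem isCompactOperator_cfcAbs_mul_self {A : H →L[ℂ] H} (hA : IsCompactOperator A) :
    IsCompactOperator (CFC.abs A * CFC.abs A : H →L[ℂ] H) := by
  rw [CFC.abs_mul_abs]
  exact hA.clm_comp (star A)

theorem finiteDimensional_singularSpace {A : H →L[ℂ] H} (hA : IsCompactOperator A) {s : ℝ≥0}
    (hs : s ≠ 0) : FiniteDimensional ℂ (singularSpace A s) := by
  have h := finite_dimensional_eigenspace (isCompactOperator_cfcAbs_mul_self hA)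
    (((s : ℝ) : ℂ) * ((s : ℝ) : ℂ)) (by simpa using hs)
  have hle : singularSpace A s ≤ eigenspace
      ((CFC.abs A * CFC.abs A : H →L[ℂ] H) : H →ₗ[ℂ] H) (((s : ℝ) : ℂ) * ((s : ℝ) : ℂ)) := ?_
  · exact Submodule.finiteDimensional_of_le hle
  intro x hx
  rw [mem_singularSpace] at hx
  refine mem_eigenspace_iff.2 ?_
  change CFC.abs A (CFC.abs A x) = _
  rw [hx, map_smul, hx, smul_smul]

/-- By the spectral theorem the eigenspaces of `Q² = |A|²` have trivial common orthogonal
complement. If `Q² x = ν² x` with `ν ≠ 0`, then `x` is a combination of `Q x ± ν x`, which lie in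
the eigenspaces of `Q` at `±ν`; if `ν = 0`, symmetry gives `Q x = 0`. -/
theorem orthogonal_iSup_eigenspace_cfcAbs {A : H →L[ℂ] H} (hA : IsCompactOperator A) :
    (⨆ μ, eigenspace ((CFC.abs A : H →L[ℂ] H) : H →ₗ[ℂ] H) μ)ᗮ = ⊥ := by
  set Q : H →L[ℂ] H := CFC.abs A with hQ
  have hsym : (Q : H →ₗ[ℂ] H).IsSymmetric := isSymmetric_cfcAbs A
  have h := orthogonalComplement_iSup_eigenspaces_eq_bot
    (isCompactOperator_cfcAbs_mul_self hA) (fun x y => by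
      change inner ℂ (Q (Q x)) y = inner ℂ x (Q (Q y))
      rw [← coe_coe Q, hsym, hsym])
  rw [← le_bot_iff, ← h]
  refine Submodule.orthogonal_le (iSup_le fun μ x hx => ?_)
  have hx' : Q (Q x) = μ • x := mem_eigenspace_iff.1 hx
  obtain ⟨ν, hν⟩ := IsAlgClosed.exists_pow_nat_eq μ (n := 2) two_pos
  rcases eq_or_ne ν 0 with rfl | hν0
  · have h0 : Q (Q x) = 0 := by rw [hx', ← hν]; simp
    have h1 : Q x = 0 := by
      rw [← inner_self_eq_zero (𝕜 := ℂ)]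
      have := hsym x (Q x)
      rw [coe_coe, h0, inner_zero_right] at this
      exact this
    exact Submodule.mem_iSup_of_mem (0 : ℂ) (mem_eigenspace_iff.2 (by simpa using h1))
  · have h1 : Q x + ν • x ∈ ⨆ μ, eigenspace (Q : H →ₗ[ℂ] H) μ :=
      Submodule.mem_iSup_of_mem ν (mem_eigenspace_iff.2 (by
        rw [coe_coe, map_add, map_smul, hx', ← hν, smul_add, smul_smul, sq, add_comm]))
    have h2 : Q x - ν • x ∈ ⨆ μ, eigenspace (Q : H →ₗ[ℂ] H) μ :=
      Submodule.mem_iSup_of_mem (-ν) (mem_eigenspace_iff.2 (by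
        rw [coe_coe, map_sub, map_smul, hx', ← hν, smul_sub, smul_smul, sq]
        module))
    have h3 : x = (2 * ν)⁻¹ • ((Q x + ν • x) - (Q x - ν • x)) := by
      rw [add_sub_sub_cancel, ← two_smul ℂ, smul_smul, smul_smul, mul_assoc,
        inv_mul_cancel₀ (by simpa), one_smul]
    rw [h3]
    exact Submodule.smul_mem _ _ (Submodule.sub_mem _ h1 h2)

theorem inner_eq_zero_of_mem_singularSpace {A : H →L[ℂ] H} {s t : ℝ≥0} (hst : s ≠ t) {x y : H}
    (hx : x ∈ singularSpace A s) (hy : y ∈ singularSpace A t) : inner ℂ x y = 0 :=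
  Submodule.isOrtho_iff_inner_eq.1 ((isSymmetric_cfcAbs A).orthogonalFamily_eigenspaces.isOrtho
    (i := ((s : ℝ) : ℂ)) (j := ((t : ℝ) : ℂ)) (by simpa using hst)) x hx y hy

/-- Schmidt expansion `A x = ∑ ⟨u, x⟩ A u` over orthonormal eigenvectors `u` of `|A|` at nonzero
`s`, where `‖A u‖ = ‖|A| u‖ = s`. The series defines a bounded operator `S` that agrees with `A` on
all eigenspaces of `|A|`, hence everywhere by density. -/
theorem IsTraceClass.hasNuclearBound {A : H →L[ℂ] H} (hA : IsTraceClass A) :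
    HasNuclearBound A (traceNorm A).toReal := by
  have hfin : ∀ s : {s : ℝ≥0 // s ≠ 0}, FiniteDimensional ℂ (singularSpace A s) := fun s =>
    finiteDimensional_singularSpace hA.isCompact s.2
  let ι : Type := Σ s : {s : ℝ≥0 // s ≠ 0}, Fin (Module.finrank ℂ (singularSpace A s))
  let u : ι → H := fun p => (stdOrthonormalBasis ℂ (singularSpace A p.1) p.2 : H)
  have hu : ∀ p : ι, u p ∈ singularSpace A p.1 := fun p => Subtype.mem _
  have hnu : ∀ p : ι, ‖u p‖ = 1 := fun p =>
    (stdOrthonormalBasis ℂ (singularSpace A p.1)).orthonormal.1 p.2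
  have hval : ∀ p : ι, ‖u p‖ * ‖A (u p)‖ = ((p.1 : ℝ≥0) : ℝ) := fun p => by
    rw [← norm_cfcAbs_apply, mem_singularSpace.1 (hu p), norm_smul, hnu]
    simp
  have hle : ∑' p : ι, ((p.1 : ℝ≥0) : ℝ≥0∞) ≤ traceNorm A := by
    rw [ENNReal.tsum_sigma fun (s : {s : ℝ≥0 // s ≠ 0})
      (_ : Fin (Module.finrank ℂ (singularSpace A s))) => ((s : ℝ≥0) : ℝ≥0∞)]
    simp only [tsum_fintype, Finset.sum_const, Finset.card_univ, Fintype.card_fin, nsmul_eq_mul]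
    exact ENNReal.tsum_comp_le_tsum_of_injective Subtype.val_injective
      (fun s : ℝ≥0 => (Module.finrank ℂ (singularSpace A s) : ℝ≥0∞) * (s : ℝ≥0∞))
  have hne : ∑' p : ι, ((p.1 : ℝ≥0) : ℝ≥0∞) ≠ ∞ := (hle.trans_lt hA.traceNorm_lt_top).ne
  have hs : Summable fun p : ι => ‖u p‖ * ‖A (u p)‖ := by
    simpa only [hval, ENNReal.coe_toReal] using ENNReal.summable_toReal hne
  refine ⟨ι, u, fun p => A (u p), hs, ?_, ?_⟩
  · simp only [hval]
    have h := ENNReal.toReal_mono hA.traceNorm_lt_top.ne hle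
    rwa [ENNReal.tsum_toReal_eq fun _ => ENNReal.coe_ne_top] at h
  have hsum : Summable fun p : ι => InnerProductSpace.rankOne ℂ (A (u p)) (u p) := by
    refine Summable.of_norm ?_
    simpa only [InnerProductSpace.norm_rankOne, mul_comm] using hs
  set S : H →L[ℂ] H := ∑' p : ι, InnerProductSpace.rankOne ℂ (A (u p)) (u p) with hS
  have hSx : ∀ x, HasSum (fun p => inner ℂ (u p) x • A (u p)) (S x) := fun x => by
    simpa using hsum.hasSum.mapL (ContinuousLinearMap.apply ℂ H x)
  suffices h : S = A by rwa [h] at hSx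
  have hker : (⨆ μ, eigenspace ((CFC.abs A : H →L[ℂ] H) : H →ₗ[ℂ] H) μ) ≤
      LinearMap.ker ((S - A : H →L[ℂ] H) : H →ₗ[ℂ] H) := by
    refine iSup_le fun μ x hx => ?_
    rcases eq_or_ne x 0 with rfl | hx0
    · exact Submodule.zero_mem _
    obtain ⟨s, hxs⟩ := exists_singularSpace_of_mem_eigenspace hx0 hx
    suffices h : S x = A x by simpa [sub_eq_zero] using h
    refine (hSx x).unique ?_
    rcases eq_or_ne s 0 with rfl | hs0
    · have hAx : A x = 0 := by
        rw [← norm_eq_zero, ← norm_cfcAbs_apply, mem_singularSpace.1 hxs]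
        simp
      have h0 : (fun p : ι => inner ℂ (u p) x • A (u p)) = fun _ => 0 := funext fun p => by
        rw [inner_eq_zero_of_mem_singularSpace p.1.2 (hu p) hxs, zero_smul]
      rw [hAx, h0]
      exact hasSum_zero
    · have hinj : Function.Injective
          fun i : Fin (Module.finrank ℂ (singularSpace A s)) => (⟨⟨s, hs0⟩, i⟩ : ι) :=
        fun i j hij => eq_of_heq (Sigma.mk.inj hij).2
      -- Only indices over `s` contribute, by orthogonality of eigenspaces; there the sum is a
      -- finite basis expansion of `x`.
      refine (hinj.hasSum_iff ?_).1 ?_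
      · rintro ⟨t, i⟩ hp
        have hts : (t : ℝ≥0) ≠ s := by
          rintro rfl
          exact hp ⟨i, rfl⟩
        rw [inner_eq_zero_of_mem_singularSpace hts (hu ⟨t, i⟩) hxs, zero_smul]
      · have : FiniteDimensional ℂ (singularSpace A s) := hfin ⟨s, hs0⟩
        have h := congrArg (Subtype.val : singularSpace A s → H)
          ((stdOrthonormalBasis ℂ (singularSpace A s)).sum_repr' ⟨x, hxs⟩)
        simp only [Submodule.coe_sum, Submodule.coe_smul, Submodule.coe_inner] at h
        have hA := congrArg A h
        simp only [map_sum, map_smul] at hA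
        rw [← hA]
        exact hasSum_fintype _
  have htop : LinearMap.ker ((S - A : H →L[ℂ] H) : H →ₗ[ℂ] H) = ⊤ := by
    have hcl : IsClosed ((LinearMap.ker ((S - A : H →L[ℂ] H) : H →ₗ[ℂ] H) : Submodule ℂ H) :
      Set H) := (S - A).isClosed_ker
    have h := Submodule.orthogonal_orthogonal_eq_closure
      (LinearMap.ker ((S - A : H →L[ℂ] H) : H →ₗ[ℂ] H))
    rw [hcl.submodule_topologicalClosure_eq] at h
    have hbot := Submodule.orthogonal_le hker
    rw [orthogonal_iSup_eigenspace_cfcAbs hA.isCompact, le_bot_iff] at hbot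
    rw [← h, hbot, Submodule.bot_orthogonal_eq_top]
  ext x
  have hx : x ∈ LinearMap.ker ((S - A : H →L[ℂ] H) : H →ₗ[ℂ] H) := htop ▸ Submodule.mem_top
  simpa [sub_eq_zero] using hx

end SingularValues

/-! ### Finite rank approximation in the trace norm. -/

section Truncation

variable {H : Type*} [NormedAddCommGroup H] [InnerProductSpace ℂ H]

open Module.End ContinuousLinearMap

theorem IsFiniteRank.isCompactOperator {F : H →L[ℂ] H} (hF : IsFiniteRank F) :
    IsCompactOperator F := by
  have : FiniteDimensional ℂ (LinearMap.range (F : H →ₗ[ℂ] H)) := hF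
  have : ProperSpace (LinearMap.range (F : H →ₗ[ℂ] H)) := FiniteDimensional.proper ℂ _
  have h : IsCompactOperator (F.codRestrict (LinearMap.range (F : H →ₗ[ℂ] H)) fun x => ⟨x, rfl⟩) :=
    isCompactOperator_of_locallyCompactSpace_dom _
  exact h.clm_comp (LinearMap.range (F : H →ₗ[ℂ] H)).subtypeL

variable [CompleteSpace H]

theorem IsTraceClass.smul {A : H →L[ℂ] H} (hA : IsTraceClass A) (z : ℂ) :
    IsTraceClass (z • A) := by
  refine ⟨hA.isCompact.smul z, ?_⟩
  -- For `z ≠ 0` the substitution `s ↦ ‖z‖ s` matches the eigenspaces; for `z = 0` it is not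
  -- invertible.
  rcases eq_or_ne z 0 with rfl | hz
  · have h : ∀ s : ℝ≥0, (Module.finrank ℂ (singularSpace (0 : H →L[ℂ] H) s) : ℝ≥0∞) * s = 0 :=
      fun s => by
        rcases eq_or_ne s 0 with rfl | hs
        · simp
        · have : singularSpace (0 : H →L[ℂ] H) s = ⊥ := (Submodule.eq_bot_iff _).2 fun x hx => by
            rw [mem_singularSpace, CFC.abs_zero] at hx
            simpa [hs] using hx.symm
          rw [this]; simp
    rw [zero_smul, traceNorm, ENNReal.tsum_eq_zero.2 h]
    exact ENNReal.zero_lt_top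
  · have hz' : ‖z‖₊ ≠ 0 := by simpa using hz
    have h : traceNorm (z • A) = ‖z‖₊ * traceNorm A := by
      rw [traceNorm, traceNorm, ← ENNReal.tsum_mul_left,
        ← (Equiv.mulLeft₀ ‖z‖₊ hz').tsum_eq]
      refine tsum_congr fun s => ?_
      have hE : singularSpace (z • A) (‖z‖₊ * s) = singularSpace A s := by
        ext x
        rw [mem_singularSpace, mem_singularSpace, CFC.abs_smul, NNReal.coe_mul, coe_nnnorm,
          Complex.ofReal_mul, ← smul_smul, smul_apply, ← Complex.coe_smul]
        exact smul_right_inj (by simpa using hz)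
      change (Module.finrank ℂ (singularSpace (z • A) (‖z‖₊ * s)) : ℝ≥0∞) *
        ((‖z‖₊ * s : ℝ≥0) : ℝ≥0∞) = _
      rw [hE, ENNReal.coe_mul]
      ring
    rw [h]
    exact ENNReal.mul_lt_top ENNReal.coe_lt_top hA.traceNorm_lt_top

/-- The absolute value of `A P` for an orthogonal projection `P` that commutes with `|A|`. -/
theorem cfcAbs_mul_of_commute {A P : H →L[ℂ] H} (hP : IsStarProjection P)
    (hAP : Commute P (CFC.abs A)) : CFC.abs (A * P) = CFC.abs A * P := by
  have hsa : star P = P := hP.isSelfAdjoint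
  have hid : P * P = P := hP.isIdempotentElem
  have heq : CFC.abs A * P = star P * CFC.abs A * P := by
    rw [hsa, hAP.eq, mul_assoc, hid]
  -- `|A| P = P |A| P` is nonnegative with square `(A P)* (A P)`.
  refine CFC.sqrt_unique ?_ ?_
  · calc CFC.abs A * P * (CFC.abs A * P) = CFC.abs A * P * CFC.abs A * P := by noncomm_ring
      _ = P * (CFC.abs A * CFC.abs A) * P := by rw [← hAP.eq]; noncomm_ring
      _ = star (A * P) * (A * P) := by rw [CFC.abs_mul_abs, star_mul, hsa]; noncomm_ring
  · rw [heq]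
    exact star_left_conjugate_nonneg (CFC.abs_nonneg A) P

/-- The sum of the eigenspaces of `|A|` at the nonzero elements of `S`. -/
def singularSum (A : H →L[ℂ] H) (S : Finset ℝ≥0) : Submodule ℂ H :=
  ⨆ s ∈ S.erase 0, singularSpace A s

theorem finiteDimensional_singularSum {A : H →L[ℂ] H} (hA : IsCompactOperator A)
    (S : Finset ℝ≥0) : FiniteDimensional ℂ (singularSum A S) := by
  rw [singularSum, iSup_subtype']
  have : ∀ s : {s // s ∈ S.erase 0}, FiniteDimensional ℂ (singularSpace A s) := fun s =>
    finiteDimensional_singularSpace hA (Finset.ne_of_mem_erase s.2)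
  infer_instance

theorem cfcAbs_mem_singularSum {A : H →L[ℂ] H} (S : Finset ℝ≥0) {x : H}
    (hx : x ∈ singularSum A S) : (CFC.abs A : H →L[ℂ] H) x ∈ singularSum A S := by
  suffices h : singularSum A S ≤
      (singularSum A S).comap ((CFC.abs A : H →L[ℂ] H) : H →ₗ[ℂ] H) from h hx
  refine iSup₂_le fun s hs y hy => ?_
  rw [Submodule.mem_comap, coe_coe, mem_singularSpace.1 hy]
  exact Submodule.smul_mem _ _ (Submodule.mem_iSup_of_mem s (Submodule.mem_iSup_of_mem hs hy))

theorem commute_starProjection_cfcAbs {A : H →L[ℂ] H} (S : Finset ℝ≥0)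
    [(singularSum A S).HasOrthogonalProjection] :
    Commute (singularSum A S).starProjection (CFC.abs A) := by
  ext x
  set N := singularSum A S
  have h1 : (CFC.abs A : H →L[ℂ] H) (N.starProjection x) ∈ N :=
    cfcAbs_mem_singularSum S (Submodule.starProjection_apply_mem _ _)
  have h2 : (CFC.abs A : H →L[ℂ] H) (x - N.starProjection x) ∈ Nᗮ := by
    refine (Submodule.mem_orthogonal _ _).2 fun y hy => ?_
    have h := isSymmetric_cfcAbs A y (x - N.starProjection x)
    rw [coe_coe] at h
    rw [← h]
    exact Submodule.inner_right_of_mem_orthogonal (cfcAbs_mem_singularSum S hy)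
      (N.sub_starProjection_mem_orthogonal x)
  rw [map_sub] at h2
  exact Submodule.eq_starProjection_of_mem_orthogonal h1 h2

/-- Since `|A - A P| = |A| (1 - P)`, its eigenvectors at `s ≠ 0` are eigenvectors of `|A|` killed by
`P`. For `s ∈ S` they also lie in the range of `P`, so none remain. -/
theorem traceNorm_sub_mul_starProjection_le {A : H →L[ℂ] H} (hA : IsCompactOperator A)
    (S : Finset ℝ≥0) [FiniteDimensional ℂ (singularSum A S)] :
    traceNorm (A - A * (singularSum A S).starProjection) ≤
      ∑' s : {s : ℝ≥0 // s ∉ S},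
        (Module.finrank ℂ (singularSpace A s) : ℝ≥0∞) * ((s : ℝ≥0) : ℝ≥0∞) := by
  set P := (singularSum A S).starProjection with hPdef
  have hcomm : Commute P (CFC.abs A) := commute_starProjection_cfcAbs S
  have hP : IsStarProjection P := isStarProjection_starProjection
  have habs : CFC.abs (A - A * P) = CFC.abs A * (1 - P) := by
    rw [← cfcAbs_mul_of_commute hP.one_sub ((Commute.one_left _).sub_left hcomm), mul_sub, mul_one]
  have hmem : ∀ (s : ℝ≥0), s ≠ 0 → ∀ x ∈ singularSpace (A - A * P) s,
      x ∈ singularSpace A s ∧ P x = 0 := fun s hs x hx => by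
    rw [mem_singularSpace, habs] at hx
    have h1 : P ((CFC.abs A * (1 - P) : H →L[ℂ] H) x) = 0 := by
      rw [← mul_apply_eq_comp, ← mul_assoc, hcomm.eq, mul_assoc, mul_sub, mul_one,
        hP.isIdempotentElem.eq, sub_self, mul_zero, zero_apply]
    have h2 : P x = 0 := by
      rw [hx, map_smul] at h1
      exact (smul_eq_zero.1 h1).resolve_left (by simpa using hs)
    refine ⟨?_, h2⟩
    rw [mem_singularSpace, ← hx, mul_apply_eq_comp, sub_apply, h2, one_apply_eq_self, sub_zero]
  refine le_of_le_of_eq ?_ (tsum_subtype {s : ℝ≥0 | s ∉ S}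
    (fun s => (Module.finrank ℂ (singularSpace A s) : ℝ≥0∞) * (s : ℝ≥0∞))).symm
  refine ENNReal.tsum_le_tsum fun s => ?_
  rcases eq_or_ne s 0 with rfl | hs
  · simp
  have := finiteDimensional_singularSpace hA hs
  by_cases hsS : s ∈ S
  · have hbot : singularSpace (A - A * P) s = ⊥ := (Submodule.eq_bot_iff _).2 fun x hx => by
      obtain ⟨h1, h2⟩ := hmem s hs x hx
      rw [← h2]
      symm
      refine Submodule.starProjection_eq_self_iff.2 ?_
      exact Submodule.mem_iSup_of_mem s
        (Submodule.mem_iSup_of_mem (Finset.mem_erase.2 ⟨hs, hsS⟩) h1)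
    rw [show eigenspace _ _ = _ from hbot]
    simp
  · rw [Set.indicator_of_mem (show s ∈ {s : ℝ≥0 | s ∉ S} from hsS)]
    gcongr
    exact Submodule.finrank_mono fun x hx => (hmem s hs x hx).1

theorem IsTraceClass.neBot_finiteRankNhds {A : H →L[ℂ] H} (hA : IsTraceClass A) :
    (finiteRankNhds A).NeBot := by
  have hlim := ENNReal.tendsto_tsum_compl_atTop_zero hA.traceNorm_lt_top.ne
  rw [finiteRankNhds, ((ENNReal.nhds_zero_basis.comap _).inf_principal _).neBot_iff]
  intro ε hε
  obtain ⟨S, hS⟩ := (hlim.eventually (gt_mem_nhds hε)).exists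
  have := finiteDimensional_singularSum hA.isCompact S
  refine ⟨A * (singularSum A S).starProjection,
    (traceNorm_sub_mul_starProjection_le hA.isCompact S).trans_lt hS, ?_⟩
  refine Submodule.finiteDimensional_of_le
    (S₂ := (singularSum A S).map (A : H →ₗ[ℂ] H)) ?_
  rintro _ ⟨x, rfl⟩
  exact ⟨_, Submodule.starProjection_apply_mem _ x, rfl⟩

end Truncation

/-! ### Continuity of the logarithmic series in the trace norm. -/

section LogDetSeries

variable {H : Type*} [NormedAddCommGroup H] [InnerProductSpace ℂ H]
variable {κ : Type*} (e : HilbertBasis κ ℂ H)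

/-- The terms of the series `tr log(1 + A)`. -/
def logDetTerm (A : H →L[ℂ] H) (m : ℕ+) : ℂ :=
  (-1 : ℂ) ^ ((m : ℕ) + 1) / ((m : ℕ) : ℂ) * basisTrace e (A ^ (m : ℕ))

theorem norm_neg_one_pow_div_mul (m : ℕ+) (t : ℂ) :
    ‖(-1 : ℂ) ^ ((m : ℕ) + 1) / ((m : ℕ) : ℂ) * t‖ = ‖t‖ / (m : ℕ) := by
  rw [norm_mul, norm_div, norm_pow, norm_neg, norm_one, one_pow, Complex.norm_natCast]
  ring

theorem hasSum_mul_pow_natPred {ρ : ℝ} (h0 : 0 ≤ ρ) (h1 : ρ < 1) (C : ℝ) :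
    HasSum (fun m : ℕ+ => ρ ^ m.natPred * C) ((1 - ρ)⁻¹ * C) :=
  (Equiv.pnatEquivNat.hasSum_iff (f := fun k : ℕ => ρ ^ k * C)).2
    ((hasSum_geometric_of_lt_one h0 h1).mul_right C)

theorem HasNuclearBound.summable_logDetTerm {A : H →L[ℂ] H} {C : ℝ} (hA : HasNuclearBound A C)
    (hlt : ‖A‖ < 1) : Summable (logDetTerm e A) := by
  refine Summable.of_norm_bounded (hasSum_mul_pow_natPred (norm_nonneg A) hlt C).summable
    fun m => ?_
  rw [logDetTerm, norm_neg_one_pow_div_mul, ← PNat.natPred_add_one m]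
  refine (div_le_self (norm_nonneg _) ?_).trans ((hA.pow_succ _).norm_basisTrace_le e)
  exact_mod_cast Nat.succ_pos _

variable [CompleteSpace H]

theorem finiteRankDet_eq_exp {F : H →L[ℂ] H} (hF : IsFiniteRank F) (hlt : ‖F‖ < 1) :
    finiteRankDet F = Complex.exp (∑' m, logDetTerm e F m) := by
  have := finiteDimensional_supportSpace hF
  rw [finiteRankDet, ← exp_tsum_trace_pow_eq_det
    ((F : H →ₗ[ℂ] H).restrict (mapsTo_supportSpace F)) hlt fun x => F.le_opNorm x]
  refine congrArg _ (tsum_congr fun m => ?_)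
  have hinv : ∀ x ∈ supportSpace F, ((F ^ (m : ℕ) : H →L[ℂ] H) : H →ₗ[ℂ] H) x ∈ supportSpace F := by
    rw [ContinuousLinearMap.toLinearMap_pow]
    exact Module.End.pow_apply_mem_of_forall_mem _ (mapsTo_supportSpace F)
  have hker : (supportSpace F)ᗮ ≤ LinearMap.ker ((F ^ (m : ℕ) : H →L[ℂ] H) : H →ₗ[ℂ] H) := by
    refine (supportSpace_orthogonal_le F).trans fun x hx => ?_
    obtain ⟨k, hk⟩ := Nat.exists_eq_succ_of_ne_zero m.ne_zero
    rw [LinearMap.mem_ker, hk, ContinuousLinearMap.coe_coe, pow_succ,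
      mul_apply_eq_comp]
    rw [LinearMap.mem_ker, ContinuousLinearMap.coe_coe] at hx
    rw [hx, map_zero]
  rw [logDetTerm, basisTrace_eq_trace_restrict e _ _ hinv hker, Module.End.pow_restrict]
  simp only [ContinuousLinearMap.toLinearMap_pow]

/-- The factor `m` from `pow_sub_pow` cancels the coefficient `1/m`, leaving a geometric majorant.
-/
theorem HasNuclearBound.norm_logDetTerm_sub_le {A F : H →L[ℂ] H} {C δ ρ : ℝ}
    (hA : HasNuclearBound A C) (hAF : HasNuclearBound (A - F) δ) (hAρ : ‖A‖ ≤ ρ) (hFρ : ‖F‖ ≤ ρ)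
    (m : ℕ+) : ‖logDetTerm e A m - logDetTerm e F m‖ ≤ ρ ^ m.natPred * δ := by
  have h := hAF.pow_sub_pow hAρ hFρ m.natPred
  rw [logDetTerm, logDetTerm, ← mul_sub, norm_neg_one_pow_div_mul, ← PNat.natPred_add_one m,
    ← (hA.pow_succ _).basisTrace_sub e h, div_le_iff₀ (by exact_mod_cast Nat.succ_pos _)]
  exact (h.norm_basisTrace_le e).trans_eq (by ring)

theorem IsTraceClass.sub_of_isFiniteRank {A F : H →L[ℂ] H} (hA : IsTraceClass A)
    (hF : IsFiniteRank F) (h : traceNorm (A - F) < ∞) : IsTraceClass (A - F) :=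
  ⟨hA.isCompact.sub hF.isCompactOperator, h⟩

theorem IsTraceClass.norm_tsum_logDetTerm_sub_le {A F : H →L[ℂ] H} {ρ : ℝ} (hA : IsTraceClass A)
    (hAF : IsTraceClass (A - F)) (hAρ : ‖A‖ ≤ ρ) (hFρ : ‖F‖ ≤ ρ) (hρ : ρ < 1) :
    ‖∑' m, logDetTerm e F m - ∑' m, logDetTerm e A m‖ ≤
      (1 - ρ)⁻¹ * (traceNorm (A - F)).toReal := by
  have hsA := hA.hasNuclearBound.summable_logDetTerm e (hAρ.trans_lt hρ)
  have hb := hA.hasNuclearBound.norm_logDetTerm_sub_le e hAF.hasNuclearBound hAρ hFρ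
  have hgeo := hasSum_mul_pow_natPred ((norm_nonneg _).trans hAρ) hρ (traceNorm (A - F)).toReal
  have hsub : Summable fun m => logDetTerm e A m - logDetTerm e F m :=
    Summable.of_norm_bounded hgeo.summable hb
  have hsF : Summable (logDetTerm e F) := by simpa using hsA.sub hsub
  rw [norm_sub_rev, ← hsA.tsum_sub hsF]
  exact tsum_of_norm_bounded hgeo hb

theorem IsTraceClass.hasDet_exp {A : H →L[ℂ] H} (hA : IsTraceClass A) (hlt : ‖A‖ < 1) :
    HasDet A (Complex.exp (∑' m, logDetTerm e A m)) := by
  refine ⟨hA.neBot_finiteRankNhds, ?_⟩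
  have hfr : ∀ᶠ F in finiteRankNhds A, IsFiniteRank F :=
    mem_inf_of_right (mem_principal_self _)
  have hlim : Tendsto (fun F => traceNorm (A - F)) (finiteRankNhds A) (𝓝 0) :=
    tendsto_comap.mono_left inf_le_left
  -- The trace norm dominates the operator norm, so every `F` within `ρ - ‖A‖` of `A` has `‖F‖ ≤ ρ <
  -- 1`.
  obtain ⟨ρ, hAρ, hρ⟩ := exists_between hlt
  have hev : ∀ᶠ F in finiteRankNhds A, IsFiniteRank F ∧ IsTraceClass (A - F) ∧ ‖F‖ ≤ ρ := by
    filter_upwards [hfr, hlim.eventually (gt_mem_nhds (ENNReal.ofReal_pos.2 (sub_pos.2 hAρ)))]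
      with F hF hδ
    have hAF := hA.sub_of_isFiniteRank hF (hδ.trans ENNReal.ofReal_lt_top)
    refine ⟨hF, hAF, ?_⟩
    have h1 := hAF.hasNuclearBound.norm_le
    have h2 : (traceNorm (A - F)).toReal ≤ ρ - ‖A‖ :=
      ENNReal.toReal_le_of_le_ofReal (sub_pos.2 hAρ).le hδ.le
    have h3 := norm_sub_norm_le F A
    rw [norm_sub_rev] at h3
    linarith
  have hlim' : Tendsto (fun F => (1 - ρ)⁻¹ * (traceNorm (A - F)).toReal) (finiteRankNhds A)
      (𝓝 0) := by
    simpa using ((ENNReal.tendsto_toReal ENNReal.zero_ne_top).comp hlim).const_mul (1 - ρ)⁻¹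
  have hlog : Tendsto (fun F => ∑' m, logDetTerm e F m) (finiteRankNhds A)
      (𝓝 (∑' m, logDetTerm e A m)) := by
    rw [tendsto_iff_norm_sub_tendsto_zero]
    refine squeeze_zero' (Eventually.of_forall fun F => norm_nonneg _) ?_ hlim'
    filter_upwards [hev] with F hF
    exact hA.norm_tsum_logDetTerm_sub_le e hF.2.1 hAρ.le hF.2.2 hρ
  refine ((Complex.continuous_exp.tendsto _).comp hlog).congr' ?_
  filter_upwards [hev] with F hF
  exact (finiteRankDet_eq_exp e hF.1 (hF.2.2.trans_lt hρ)).symm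

end LogDetSeries

/-! ### Matrix symbols of Fourier multipliers. -/

section Symbol

variable {H : Type*} [NormedAddCommGroup H] [InnerProductSpace ℂ H]
variable {d : ℕ → ℕ} {e : HilbertBasis (Σ j : ℕ, Fin (d j)) ℂ H}

theorem IsFourierMultiplier.apply_eq_sum {T : H →L[ℂ] H} (hT : IsFourierMultiplier e T) (l : ℕ)
    (k : Fin (d l)) : T (e ⟨l, k⟩) = ∑ m, matrixSymbol e T l m k • e ⟨l, m⟩ := by
  have hmem : T (e ⟨l, k⟩) ∈ block e l := hT l _ (Submodule.subset_span ⟨k, rfl⟩)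
  obtain ⟨c, hc⟩ := (Submodule.mem_span_range_iff_exists_fun ℂ).1 hmem
  have hon : Orthonormal ℂ fun m : Fin (d l) => e ⟨l, m⟩ :=
    e.orthonormal.comp _ fun i j hij => eq_of_heq (Sigma.mk.inj hij).2
  rw [← hc]
  refine Finset.sum_congr rfl fun m _ => ?_
  rw [matrixSymbol, Matrix.of_apply, ← hc, hon.inner_right_fintype]

theorem IsFourierMultiplier.pow_apply_eq_sum {T : H →L[ℂ] H} (hT : IsFourierMultiplier e T)
    (n l : ℕ) (k : Fin (d l)) :
    (T ^ n) (e ⟨l, k⟩) = ∑ m, (matrixSymbol e T l ^ n) m k • e ⟨l, m⟩ := by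
  induction n with
  | zero => simp [Matrix.one_apply]
  | succ n ih =>
    rw [pow_succ', mul_apply_eq_comp, ih, map_sum, pow_succ']
    simp only [map_smul, hT.apply_eq_sum, Finset.smul_sum, Matrix.mul_apply, Finset.sum_smul,
      smul_smul]
    rw [Finset.sum_comm]
    simp only [mul_comm]

theorem IsFourierMultiplier.trace_matrixSymbol_pow {T : H →L[ℂ] H} (hT : IsFourierMultiplier e T)
    (n l : ℕ) : (matrixSymbol e T l ^ n).trace =
      ∑ k, inner ℂ (e ⟨l, k⟩) ((T ^ n) (e ⟨l, k⟩)) := by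
  have hon : Orthonormal ℂ fun m : Fin (d l) => e ⟨l, m⟩ :=
    e.orthonormal.comp _ fun i j hij => eq_of_heq (Sigma.mk.inj hij).2
  refine Finset.sum_congr rfl fun k _ => ?_
  rw [hT.pow_apply_eq_sum, hon.inner_right_fintype, Matrix.diag_apply]

/-- The diagonal of `T^n` is unconditionally summable, so it may be grouped by blocks. -/
theorem IsFourierMultiplier.hasSum_trace_matrixSymbol_pow {T : H →L[ℂ] H} {n : ℕ} {C : ℝ}
    (hT : IsFourierMultiplier e T) (h : HasNuclearBound (T ^ n) C) :
    HasSum (fun l => (matrixSymbol e T l ^ n).trace) (basisTrace e (T ^ n)) := by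
  simp only [hT.trace_matrixSymbol_pow]
  exact (h.hasSum_basisTrace e).sigma fun l => hasSum_fintype _

end Symbol

end InvariantDet

end

theorem mainTheorem2 {H : Type*} [NormedAddCommGroup H] [InnerProductSpace ℂ H] [CompleteSpace H]
    {d : ℕ → ℕ} (e : HilbertBasis (Σ j : ℕ, Fin (d j)) ℂ H) (T : H →L[ℂ] H)
    (hT : InvariantDet.IsTraceClass T) (hinv : InvariantDet.IsFourierMultiplier e T) :
    (∀ m : ℕ+, Summable fun l : ℕ => (InvariantDet.matrixSymbol e T l ^ (m : ℕ)).trace) ∧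
    ∃ r : ℝ, 0 < r ∧ ∀ z : ℂ, ‖z‖ < r →
      InvariantDet.HasDet (z • T) (InvariantDet.traceClassDet (z • T)) ∧
      (Summable fun m : ℕ+ => (-1 : ℂ) ^ ((m : ℕ) + 1) / ((m : ℕ) : ℂ) * z ^ (m : ℕ) *
        ∑' l : ℕ, (InvariantDet.matrixSymbol e T l ^ (m : ℕ)).trace) ∧
      InvariantDet.traceClassDet (z • T) =
        Complex.exp (∑' m : ℕ+, (-1 : ℂ) ^ ((m : ℕ) + 1) / ((m : ℕ) : ℂ) * z ^ (m : ℕ) *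
          ∑' l : ℕ, (InvariantDet.matrixSymbol e T l ^ (m : ℕ)).trace) := by
  have htr : ∀ m : ℕ+, HasSum (fun l : ℕ => (InvariantDet.matrixSymbol e T l ^ (m : ℕ)).trace)
      (InvariantDet.basisTrace e (T ^ (m : ℕ))) := fun m => by
    obtain ⟨k, hk⟩ := Nat.exists_eq_succ_of_ne_zero m.ne_zero
    exact hinv.hasSum_trace_matrixSymbol_pow
      (C := ‖T‖ ^ k * (InvariantDet.traceNorm T).toReal)
      (by rw [hk]; exact hT.hasNuclearBound.pow_succ k)
  -- `Summable` in `ℂ` is absolute convergence. The radius ensures `‖z • T‖ < 1`, also when `T = 0`.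
  refine ⟨fun m => (htr m).summable, (‖T‖ + 1)⁻¹, by positivity, fun z hz => ?_⟩
  have hlt : ‖z • T‖ < 1 := by
    have h := (lt_inv_mul_iff₀ (by positivity)).1 ((mul_one (‖T‖ + 1)⁻¹).symm ▸ hz)
    rw [norm_smul]
    nlinarith [norm_nonneg z]
  have hterm : ∀ m : ℕ+, (-1 : ℂ) ^ ((m : ℕ) + 1) / ((m : ℕ) : ℂ) * z ^ (m : ℕ) *
      ∑' l : ℕ, (InvariantDet.matrixSymbol e T l ^ (m : ℕ)).trace =
        InvariantDet.logDetTerm e (z • T) m := fun m => by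
    rw [(htr m).tsum_eq, InvariantDet.logDetTerm, smul_pow, InvariantDet.basisTrace_smul, mul_assoc]
  have hz := hT.smul z
  have hdet := hz.hasDet_exp e hlt
  simp only [hterm]
  refine ⟨?_, hz.hasNuclearBound.summable_logDetTerm e hlt, hdet.traceClassDet_eq⟩
  rwa [hdet.traceClassDet_eq]
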